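/- Let $\mathcal{C}$ be a class of groups. We say that the *Membership Problem is solvable* in $\mathcal{C}$ if there is an algorithm which takes as input a finite presentation $\langle A\mid R\rangle$, a finite list of words $w_1,\dots,w_k$ in $A^{\pm 1}$ and a word $z$ in $A^{\pm 1}$, and which, whenever $\langle A\mid R\rangle$ is a presentation for a group $\pi$ isomorphic to a group in $\mathcal{C}$, halts and determines whether or not the element of $\pi$ represented by $z$ lies in the subgroup of $\pi$ generated by the elements represented by $w_1,\dots,w_k$. (Nothing is required of the algorithm on other inputs.) We say that $\mathcal{C}$ is *recursively enumerable* if there is a Turing machine that outputs a (finite or infinite, possibly empty) list of finite presentations of groups in $\mathcal{C}$ (up to isomorphism) such that every group in $\mathcal{C}$ is isomorphic to the group defined by one of those presentations. In particular all groups in such a class are finitely presentable. **Corollary.** Let $\mathcal{C}$ be a recursively enumerable class of groups in which the Membership Problem is solvable. Then the Membership Problem is solvable in the class of all groups which are isomorphic to a finite free product $G_1*\cdots*G_n$, $n\ge 0$, of groups $G_1,\dots,G_n$ in $\mathcal{C}$ (the empty free product being the trivial group). -/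

import Mathlib

universe u

/-- A word in the letters `x₀, …, xₙ₋₁` and their inverses: `(i, true)` stands for `xᵢ` and
`(i, false)` for `xᵢ⁻¹`, the convention of `FreeGroup.mk`. Words need not be reduced. -/
abbrev GroupWord (n : ℕ) : Type := List (Fin n × Bool)

/-- A finite group presentation `⟨x₀, …, xₙ₋₁ ∣ r₁, …, rₘ⟩`. -/
structure FinitePresentation where
  /-- the number of generators -/
  numGens : ℕ
  /-- the list of relators -/
  relators : List (GroupWord numGens)

namespace FinitePresentation

/-- The set of elements of the free group given by the relators. -/
def relatorSet (P : FinitePresentation) : Set (FreeGroup (Fin P.numGens)) :=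
  {g | ∃ r ∈ P.relators, g = FreeGroup.mk r}

/-- The group defined by the presentation. -/
abbrev toGroup (P : FinitePresentation) : Type := PresentedGroup P.relatorSet

/-- The element of the presented group represented by a word. -/
def eval (P : FinitePresentation) (w : GroupWord P.numGens) : P.toGroup :=
  PresentedGroup.mk P.relatorSet (FreeGroup.mk w)

end FinitePresentation

/-- Words as they are read and written by an algorithm: lists of signed natural numbers. -/
abbrev WordCode : Type := List (ℕ × Bool)

/-- Presentations as they are read and written by an algorithm: the number of generators, and the
list of relators. -/
abbrev PresentationCode : Type := ℕ × List WordCode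

/-- The code of a word. -/
def GroupWord.code {n : ℕ} (w : GroupWord n) : WordCode :=
  w.map fun x => ((x.1 : ℕ), x.2)

/-- The code of a finite presentation. -/
def FinitePresentation.code (P : FinitePresentation) : PresentationCode :=
  (P.numGens, P.relators.map GroupWord.code)

/-- A class of groups, given as a property of groups (not assumed invariant under isomorphism). -/
abbrev GroupClass : Type (u + 1) := ∀ (G : Type u) [Group G], Prop

/-- `P` is a presentation for a group in the class `C`: the group it defines is isomorphic to
a group in `C`. -/
def FinitePresentation.PresentsGroupIn (P : FinitePresentation) (C : GroupClass.{u}) : Prop :=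
  ∃ (G : Type u) (_ : Group G), C G ∧ Nonempty (P.toGroup ≃* G)

/-- The Membership Problem is solvable in `C`: there is an algorithm (a partial recursive
function) which takes as input a finite presentation `P`, a finite list of words `w₁, …, w_k` and a
word `z`, and which, whenever `P` is a presentation for a group in `C`, halts and decides whether
`z` represents an element of the subgroup generated by `w₁, …, w_k`. -/
def MembershipProblemSolvable (C : GroupClass.{u}) : Prop :=
  ∃ f : PresentationCode × List WordCode × WordCode →. Bool, Partrec f ∧
    ∀ P : FinitePresentation, P.PresentsGroupIn C →
      ∀ (ws : List (GroupWord P.numGens)) (z : GroupWord P.numGens),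
        ∃ b ∈ f (P.code, ws.map GroupWord.code, GroupWord.code z),
          (b = true ↔ P.eval z ∈ Subgroup.closure {g | ∃ w ∈ ws, g = P.eval w})

/-- `C` is recursively enumerable: there is an algorithm that outputs a (finite or infinite,
possibly empty) list of finite presentations, each a presentation for a group in `C`, such that
every group in `C` is isomorphic to the group defined by one of them. The value `L t` is what is
written at stage `t`, with `none` if nothing is written at that stage. -/
def RecursivelyEnumerableClass (C : GroupClass.{u}) : Prop :=
  ∃ L : ℕ → Option PresentationCode, Computable L ∧
    (∀ t c, L t = some c → ∃ P : FinitePresentation, P.code = c ∧ P.PresentsGroupIn C) ∧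
    ∀ (G : Type u) [Group G], C G →
      ∃ (t : ℕ) (P : FinitePresentation), L t = some P.code ∧ Nonempty (G ≃* P.toGroup)

/-- The class of groups that are isomorphic to a finite free product `G₁ * ⋯ * Gₙ` of groups in
`C`, for some `n ≥ 0`. -/
def FiniteFreeProductClass (C : GroupClass.{u}) : GroupClass.{u} := fun G _ =>
  ∃ (n : ℕ) (H : Fin n → Type u) (_ : ∀ i, Group (H i)),
    (∀ i, C (H i)) ∧ Nonempty (G ≃* Monoid.CoprodI H)

-- Membership and nonmembership are both semidecidable on the inputs in question, so running the two
-- searches in parallel decides. For membership any finite presentation will do: list the products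
-- of the given words, the conjugates of relators, and their inverses.
--
-- For nonmembership, search for a finite certificate: factors listed by the enumeration of `C`,
-- words `φ` defining a homomorphism from the given group to their free product `M`, and a finite
-- piece of an `M`-set in which the words `wᵢ` fix a point `b` and `z` moves it. Under the `i`-th
-- factor, each point of the piece is recorded as a coset of a finitely generated subgroup. Whether
-- a letter carries one coset to another, and whether two cosets differ, are membership questions in
-- that factor, hence answered by the algorithm for `C`.
--
-- Soundness (`IsNonmembershipCertificate.notMem`): each factor acts on its own coset spaces, and
-- these actions extend to one set containing the piece (`exists_common_action`). Separate actions
-- of the factors need no compatibility to give an action of the free product. Injectivity of `φ` is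
-- not needed.
--
-- Completeness (`exists_isNonmembershipCertificate`): take `φ` from an isomorphism with a free
-- product, let `S` be the image of the subgroup, and keep the finitely many points of `M ⧸ S`
-- visited while reading the words. Stabilizers in a factor may fail to be finitely generated, but
-- the part generated by the observed transitions is enough (`exists_pointCodes`): it makes these
-- transitions correct and, lying in the stabilizer, merges no points.

attribute [fun_prop] Computable

/-! ### Closure properties of computable functions -/

namespace Computable

variable {α β γ σ : Type*} [Primcodable α] [Primcodable β] [Primcodable γ] [Primcodable σ]

@[fun_prop]
theorem fun_id : Computable fun a : α => a := Computable.id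

@[fun_prop]
theorem fun_const (s : σ) : Computable fun _ : α => s := Computable.const s

@[fun_prop]
theorem fun_comp {f : β → σ} {g : α → β} (hf : Computable f) (hg : Computable g) :
    Computable fun a => f (g a) := hf.comp hg

@[fun_prop]
theorem fun_fst {f : α → β × γ} (hf : Computable f) : Computable fun a => (f a).1 :=
  Computable.fst.comp hf

@[fun_prop]
theorem fun_snd {f : α → β × γ} (hf : Computable f) : Computable fun a => (f a).2 :=
  Computable.snd.comp hf

@[fun_prop]
theorem fun_mk {f : α → β} {g : α → γ} (hf : Computable f) (hg : Computable g) :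
    Computable fun a => (f a, g a) := hf.pair hg

@[fun_prop]
theorem fun_append {f g : α → List β} (hf : Computable f) (hg : Computable g) :
    Computable fun a => f a ++ g a := Computable.list_append.comp hf hg

@[fun_prop]
theorem fun_cons {f : α → β} {g : α → List β} (hf : Computable f) (hg : Computable g) :
    Computable fun a => f a :: g a := Computable.list_cons.comp hf hg

@[fun_prop]
theorem fun_getD {f : α → List β} {g : α → ℕ} (d : β) (hf : Computable f) (hg : Computable g) :
    Computable fun a => (f a).getD (g a) d := (Primrec.list_getD d).to_comp.comp hf hg

@[fun_prop]
theorem fun_length {f : α → List β} (hf : Computable f) : Computable fun a => (f a).length :=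
  Computable.list_length.comp hf

@[fun_prop]
theorem fun_succ {f : α → ℕ} (hf : Computable f) : Computable fun a => f a + 1 :=
  Computable.succ.comp hf

@[fun_prop]
theorem fun_unpair {f : α → ℕ} (hf : Computable f) : Computable fun a => (f a).unpair :=
  Computable.unpair.comp hf

@[fun_prop]
theorem fun_some {f : α → β} (hf : Computable f) : Computable fun a => some (f a) :=
  Computable.option_some.comp hf

@[fun_prop]
theorem fun_flatten {f : α → List (List β)} (hf : Computable f) :
    Computable fun a => (f a).flatten := Primrec.list_flatten.to_comp.comp hf

@[fun_prop]
theorem fun_getElem? {f : α → List β} {g : α → ℕ} (hf : Computable f) (hg : Computable g) :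
    Computable fun a => (f a)[g a]? := Computable.list_getElem?.comp hf hg

end Computable

/-! ### Recursively enumerable predicates -/

namespace REPred

variable {α β γ σ : Type*} [Primcodable α] [Primcodable β] [Primcodable γ] [Primcodable σ]

theorem comp {p : β → Prop} (hp : REPred p) {g : α → β} (hg : Computable g) :
    REPred fun a => p (g a) := Partrec.comp hp hg

theorem and {p q : α → Prop} (hp : REPred p) (hq : REPred q) : REPred fun a => p a ∧ q a :=
  (Partrec.dom_re (Partrec.bind hp (hq.comp Computable.fst).to₂)).of_eq fun a => by
    simp [Part.assert]

theorem or {p q : α → Prop} (hp : REPred p) (hq : REPred q) : REPred fun a => p a ∨ q a := by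
  obtain ⟨k, hk, h⟩ := Partrec.merge' hp hq
  exact (Partrec.dom_re hk).of_eq fun a => by simpa [Part.assert] using (h a).2

theorem of_primrecPred {p : α → Prop} (hp : PrimrecPred p) : REPred p := by
  obtain ⟨_, h⟩ := hp
  exact ComputablePred.to_re ⟨_, h.to_comp⟩

theorem eq {f g : α → β} (hf : Computable f) (hg : Computable g) : REPred fun a => f a = g a := by
  classical
  exact (of_primrecPred (p := fun x : β × β => x.1 = x.2) Primrec.eq).comp (hf.pair hg)

theorem ne {f g : α → β} (hf : Computable f) (hg : Computable g) : REPred fun a => f a ≠ g a := by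
  classical
  exact (of_primrecPred (p := fun x : β × β => x.1 ≠ x.2) (Primrec.eq.not)).comp (hf.pair hg)

theorem lt {f g : α → ℕ} (hf : Computable f) (hg : Computable g) : REPred fun a => f a < g a :=
  (of_primrecPred (p := fun x : ℕ × ℕ => x.1 < x.2) Primrec.nat_lt).comp (hf.pair hg)

/-- The projection of a recursively enumerable relation is recursively enumerable. -/
theorem ex {p : α → β → Prop} (hp : REPred fun x : α × β => p x.1 x.2) :
    REPred fun a => ∃ b, p a b := by
  obtain ⟨c, hc⟩ := Nat.Partrec.Code.exists_code.1 hp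
  -- Dovetailing: `m` codes a step bound together with a candidate witness, so one unbounded search
  -- over `m` suffices.
  have key : ∀ a, (∃ b, p a b) ↔ ∃ m : ℕ,
      (c.evaln m.unpair.1 (Nat.pair (Encodable.encode a) m.unpair.2)).isSome = true := by
    intro a
    constructor
    · rintro ⟨b, hb⟩
      have : Encodable.encode () ∈ c.eval (Encodable.encode (a, b)) := by
        rw [hc]; simpa [hb] using ⟨(), rfl⟩
      obtain ⟨k, hk⟩ := Nat.Partrec.Code.evaln_complete.1 this
      refine ⟨Nat.pair k (Encodable.encode b), ?_⟩
      rw [Nat.unpair_pair]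
      exact Option.isSome_iff_exists.2 ⟨_, hk⟩
    · rintro ⟨m, hm⟩
      obtain ⟨y, hy⟩ := Option.isSome_iff_exists.1 hm
      have := Nat.Partrec.Code.evaln_sound hy
      rw [hc] at this
      simp only [Part.mem_bind_iff, Part.mem_map_iff, Part.mem_ofOption, Option.mem_def,
        Part.mem_assert_iff] at this
      obtain ⟨⟨a', b⟩, h1, -, ⟨h2, -⟩, -⟩ := this
      simp only [Encodable.decode_prod_val, Nat.unpair_pair,
        Encodable.encodek, Option.bind_some, Option.map_eq_some_iff, Prod.mk.injEq] at h1
      obtain ⟨b', -, rfl, rfl⟩ := h1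
      exact ⟨_, h2⟩
  have hcomp : Computable₂ fun (a : α) (m : ℕ) =>
      (c.evaln m.unpair.1 (Nat.pair (Encodable.encode a) m.unpair.2)).isSome := by
    refine Primrec₂.to_comp (Primrec.option_isSome.comp
      (Nat.Partrec.Code.primrec_evaln.comp (.pair (.pair ?_ (.const c)) (Primrec₂.natPair.comp ?_ ?_))))
    · exact Primrec.fst.comp (Primrec.unpair.comp Primrec.snd)
    · exact Primrec.encode.comp Primrec.fst
    · exact Primrec.snd.comp (Primrec.unpair.comp Primrec.snd)
  refine (Partrec.dom_re (Partrec.rfind hcomp.partrec₂)).of_eq fun a => ?_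
  rw [key, Nat.rfind_dom]
  simp

/-- The `n a` semidecision procedures run one after another by recursion; the computation halts
exactly when all of them do. -/
theorem forall_lt {p : α → ℕ → Prop} {n : α → ℕ} (hn : Computable n)
    (hp : REPred fun x : α × ℕ => p x.1 x.2) : REPred fun a => ∀ j < n a, p a j := by
  have := Partrec.nat_rec (f := n) (g := fun _ => Part.some ())
    (h := fun (a : α) (x : ℕ × Unit) => Part.assert (p a x.1) fun _ => Part.some ()) hn
    (Computable.const ()).partrec
    ((Partrec.comp hp (g := fun y : α × ℕ × Unit => (y.1, y.2.1)) (by fun_prop)).to₂)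
  refine (Partrec.dom_re this).of_eq fun a => ?_
  generalize n a = m
  induction m with
  | zero => simp
  | succ k ih =>
    rw [Nat.forall_lt_succ_right, ← ih]
    simp [Part.assert]

theorem exists_lt {p : α → ℕ → Prop} {n : α → ℕ} (hn : Computable n)
    (hp : REPred fun x : α × ℕ => p x.1 x.2) : REPred fun a => ∃ j < n a, p a j :=
  ex ((lt Computable.snd (hn.comp Computable.fst)).and hp)

theorem exists_mem {p : α → β → Prop} {l : α → List β} (hl : Computable l)
    (hp : REPred fun x : α × β => p x.1 x.2) : REPred fun a => ∃ b ∈ l a, p a b := by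
  have : REPred fun a => ∃ x : ℕ × β, (l a)[x.1]? = some x.2 ∧ p a x.2 :=
    ex ((eq (by fun_prop) (by fun_prop)).and (hp.comp (g := fun y : α × ℕ × β => (y.1, y.2.2)) (by fun_prop)))
  refine this.of_eq fun a => ?_
  simp only [List.mem_iff_getElem?, Prod.exists]
  grind

theorem mem {f : α → β} {l : α → List β} (hf : Computable f) (hl : Computable l) :
    REPred fun a => f a ∈ l a :=
  (exists_mem (p := fun a b => f a = b) hl (eq (by fun_prop) (by fun_prop))).of_eq
    fun a => by simp

theorem forall_mem {p : α → β → Prop} {l : α → List β} (hl : Computable l)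
    (hp : REPred fun x : α × β => p x.1 x.2) : REPred fun a => ∀ b ∈ l a, p a b := by
  have : REPred fun a => ∀ j < (l a).length, ∃ b, (l a)[j]? = some b ∧ p a b :=
    forall_lt (by fun_prop) (ex ((eq (by fun_prop) (by fun_prop)).and
      (hp.comp (g := fun y : (α × ℕ) × β => (y.1.1, y.2)) (by fun_prop))))
  refine this.of_eq fun a => ?_
  constructor
  · intro h b hb
    obtain ⟨j, hj, rfl⟩ := List.mem_iff_getElem.1 hb
    obtain ⟨c, h1, h2⟩ := h j hj
    rw [List.getElem?_eq_getElem hj, Option.some_inj] at h1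
    rwa [h1]
  · intro h j hj
    exact ⟨_, List.getElem?_eq_getElem hj, h _ (List.getElem_mem hj)⟩

/-- Run `f` and compare its output. Positive and negative answers of a partial algorithm can thus
both be used inside a certificate. -/
theorem mem_partrec {f : α →. β} (hf : Partrec f) {g : α → β} (hg : Computable g) :
    REPred fun a => g a ∈ f a := by
  have : Partrec₂ fun (a : α) (b : β) => Part.assert (g a = b) fun _ => Part.some () :=
    (eq (f := fun x : α × β => g x.1) (g := fun x => x.2) (by fun_prop) (by fun_prop)).to₂
  refine (Partrec.dom_re (hf.bind this)).of_eq fun a => ?_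
  simp only [Part.dom_iff_mem, Part.mem_bind_iff, Part.mem_assert_iff, Part.mem_some_iff]
  constructor
  · rintro ⟨_, b, hb, rfl, _⟩
    exact hb
  · intro h
    exact ⟨(), _, h, rfl, trivial⟩

/-- Two complementary recursively enumerable predicates, complementary only on part of the inputs,
yield a partial decision procedure. -/
theorem exists_partrec_decide {p q : α → Prop} (hp : REPred p) (hq : REPred q) :
    ∃ f : α →. Bool, Partrec f ∧ ∀ a, (q a ↔ ¬ p a) → ∃ b ∈ f a, (b = true ↔ p a) := by
  obtain ⟨k, hk, h⟩ := Partrec.merge' (Partrec.map hp (Computable.const true).to₂)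
    (Partrec.map hq (Computable.const false).to₂)
  refine ⟨k, hk, fun a ha => ?_⟩
  have hd : (k a).Dom := by
    rw [(h a).2]
    simp [Part.assert, ha, em]
  refine ⟨_, Part.get_mem hd, ?_⟩
  have := (h a).1 _ (Part.get_mem hd)
  simp [ha] at this
  grind

end REPred

/-! ### Computability of operations on words -/

namespace Computable

variable {α β γ σ : Type*} [Primcodable α] [Primcodable β] [Primcodable γ] [Primcodable σ]

/-- The step function copies the recursion defining `FreeGroup.reduce`, so that the two agree by
`rfl`. -/
theorem freeGroup_reduce : Computable (FreeGroup.reduce : WordCode → WordCode) := by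
  refine Primrec.to_comp (Primrec.of_eq
    (Primrec.list_rec (f := fun w : WordCode => w) (g := fun _ => ([] : WordCode))
      (h := fun _ x => List.casesOn x.2.2 [x.1] fun hd tl =>
        if x.1.1 = hd.1 ∧ x.1.2 = !hd.2 then tl else x.1 :: hd :: tl)
      Primrec.id (Primrec.const _) ?_) fun w => rfl)
  refine Primrec.list_casesOn (f := fun y : WordCode × (ℕ × Bool) × WordCode × WordCode => y.2.2.2)
    (g := fun y => [y.2.1]) (h := fun y z =>
      if y.2.1.1 = z.1.1 ∧ y.2.1.2 = !z.1.2 then z.2 else y.2.1 :: z.1 :: z.2) ?_ ?_ ?_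
  · exact Primrec.snd.comp (Primrec.snd.comp Primrec.snd)
  · exact Primrec.list_cons.comp (Primrec.fst.comp Primrec.snd) (Primrec.const _)
  · have h1 : Primrec fun p : (WordCode × (ℕ × Bool) × WordCode × WordCode) ×
        ((ℕ × Bool) × WordCode) => p.1.2.1 :=
      Primrec.fst.comp (Primrec.snd.comp Primrec.fst)
    have h2 : Primrec fun p : (WordCode × (ℕ × Bool) × WordCode × WordCode) ×
        ((ℕ × Bool) × WordCode) => p.2.1 := Primrec.fst.comp Primrec.snd
    have h3 : Primrec fun p : (WordCode × (ℕ × Bool) × WordCode × WordCode) ×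
        ((ℕ × Bool) × WordCode) => p.2.2 := Primrec.snd.comp Primrec.snd
    refine Primrec.ite (PrimrecPred.and ?_ ?_) h3
      (Primrec.list_cons.comp h1 (Primrec.list_cons.comp h2 h3))
    · exact Primrec.eq.comp (Primrec.fst.comp h1) (Primrec.fst.comp h2)
    · exact Primrec.eq.comp (Primrec.snd.comp h1) (Primrec.not.comp (Primrec.snd.comp h2))

@[fun_prop]
theorem fun_reduce {f : α → WordCode} (hf : Computable f) :
    Computable fun a => FreeGroup.reduce (f a) := freeGroup_reduce.comp hf

theorem _root_.Primrec.freeGroup_invRev : Primrec (FreeGroup.invRev : WordCode → WordCode) := by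
  refine Primrec.list_reverse.comp (Primrec.list_map Primrec.id (Primrec.pair ?_ ?_))
  · exact Primrec.fst.comp Primrec.snd
  · exact Primrec.not.comp (Primrec.snd.comp Primrec.snd)

@[fun_prop]
theorem fun_invRev {f : α → WordCode} (hf : Computable f) :
    Computable fun a => FreeGroup.invRev (f a) := Primrec.freeGroup_invRev.to_comp.comp hf

end Computable

/-- Delete from a word all the letters whose index is not below `n`. -/
def WordCode.clean (n : ℕ) (w : WordCode) : WordCode :=
  w.flatMap fun l => if l.1 < n then [l] else []

/-- Replace each letter `k` of a word by the letter `Nat.pair i k`. -/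
def WordCode.shift (i : ℕ) (w : WordCode) : WordCode :=
  w.map fun l => (Nat.pair i l.1, l.2)

/-- Substitute the words in a list for the letters of a word. -/
def WordCode.subst (φ : List WordCode) (w : WordCode) : WordCode :=
  w.flatMap fun l => bif l.2 then φ.getD l.1 [] else FreeGroup.invRev (φ.getD l.1 [])

namespace Computable

variable {α : Type*} [Primcodable α]

@[fun_prop]
theorem fun_clean {n : α → ℕ} {f : α → WordCode} (hn : Computable n) (hf : Computable f) :
    Computable fun a => (f a).clean (n a) := by
  refine Computable.comp (f := fun x : ℕ × WordCode => x.2.clean x.1) (Primrec.to_comp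
    (Primrec.list_flatMap Primrec.snd (Primrec.ite ?_ ?_ (Primrec.const _)))) (hn.pair hf)
  · exact Primrec.nat_lt.comp (Primrec.fst.comp Primrec.snd) (Primrec.fst.comp Primrec.fst)
  · exact Primrec.list_cons.comp Primrec.snd (Primrec.const _)

@[fun_prop]
theorem fun_map_clean {n : α → ℕ} {f : α → List WordCode} (hn : Computable n)
    (hf : Computable f) : Computable fun a => (f a).map (WordCode.clean (n a)) := by
  refine Computable.comp (f := fun x : ℕ × List WordCode => x.2.map (WordCode.clean x.1))
    (Primrec.to_comp (Primrec.list_map Primrec.snd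
      (Primrec.list_flatMap Primrec.snd (Primrec.ite ?_ ?_ (Primrec.const _))))) (hn.pair hf)
  · exact Primrec.nat_lt.comp (Primrec.fst.comp Primrec.snd)
      (Primrec.fst.comp (Primrec.fst.comp Primrec.fst))
  · exact Primrec.list_cons.comp Primrec.snd (Primrec.const _)

@[fun_prop]
theorem fun_shift {n : α → ℕ} {f : α → WordCode} (hn : Computable n) (hf : Computable f) :
    Computable fun a => (f a).shift (n a) := by
  refine Computable.comp (f := fun x : ℕ × WordCode => x.2.shift x.1) (Primrec.to_comp
    (Primrec.list_map Primrec.snd (Primrec.pair ?_ ?_))) (hn.pair hf)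
  · exact Primrec₂.natPair.comp (Primrec.fst.comp Primrec.fst) (Primrec.fst.comp Primrec.snd)
  · exact Primrec.snd.comp Primrec.snd

@[fun_prop]
theorem fun_subst {n : α → List WordCode} {f : α → WordCode} (hn : Computable n)
    (hf : Computable f) : Computable fun a => (f a).subst (n a) := by
  refine Computable.comp (f := fun x : List WordCode × WordCode => x.2.subst x.1) (Primrec.to_comp
    (Primrec.list_flatMap Primrec.snd (Primrec.cond ?_ ?_ (Primrec.freeGroup_invRev.comp ?_))))
    (hn.pair hf)
  · exact Primrec.snd.comp Primrec.snd
  all_goals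
    exact (Primrec.list_getD []).comp (Primrec.fst.comp Primrec.fst)
      (Primrec.fst.comp Primrec.snd)

end Computable

/-! ### Semidecidability of membership in subgroups of a free group -/

open FreeGroup in
-- Elements of a closure are products of generators and their inverses; comparing reduced words
-- replaces equality in the free group by decidable equality of lists.
theorem mk_mem_closure_iff {T : WordCode → Prop} {z : WordCode} :
    mk z ∈ Subgroup.closure {g | ∃ y, T y ∧ g = mk y} ↔
      ∃ l : List WordCode, (∀ y ∈ l, T y ∨ T (invRev y)) ∧ reduce l.flatten = reduce z := by
  constructor
  · intro h
    obtain ⟨l, hl, hz⟩ : ∃ l : List WordCode, (∀ y ∈ l, T y ∨ T (invRev y)) ∧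
        mk l.flatten = mk z := by
      generalize mk z = g at h
      induction h using Subgroup.closure_induction with
      | mem x hx =>
        obtain ⟨y, hy, rfl⟩ := hx
        exact ⟨[y], by simp [hy], by simp⟩
      | one => exact ⟨[], by simp, rfl⟩
      | mul x y _ _ hx hy =>
        obtain ⟨l, hl, rfl⟩ := hx
        obtain ⟨m, hm, rfl⟩ := hy
        exact ⟨l ++ m, by grind, by simp [mul_mk]⟩
      | inv x _ hx =>
        obtain ⟨l, hl, rfl⟩ := hx
        refine ⟨(l.map invRev).reverse, ?_, ?_⟩
        · intro y hy
          simp only [List.mem_reverse, List.mem_map] at hy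
          obtain ⟨a, ha, rfl⟩ := hy
          rw [invRev_invRev]
          exact (hl a ha).symm
        · clear * -
          induction l with
          | nil => rfl
          | cons a l ih =>
            simp only [List.map_cons, List.reverse_cons, List.flatten_append, ← mul_mk, ih,
              List.flatten_cons, mul_inv_rev, inv_mk, List.flatten_nil, List.append_nil]
    exact ⟨l, hl, reduce.sound hz⟩
  · rintro ⟨l, hl, hz⟩
    rw [← reduce.exact hz]
    clear hz
    induction l with
    | nil => exact one_mem _
    | cons a l ih =>
      rw [List.flatten_cons, ← mul_mk]
      refine mul_mem ?_ (ih fun y hy => hl y (List.mem_cons_of_mem _ hy))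
      rcases hl a List.mem_cons_self with h | h
      · exact Subgroup.subset_closure ⟨a, h, rfl⟩
      · rw [← inv_mem_iff]
        exact Subgroup.subset_closure ⟨_, h, rfl⟩

open FreeGroup in
theorem REPred.mk_mem_closure {α : Type*} [Primcodable α] {T : α → WordCode → Prop}
    (hT : REPred fun x : α × WordCode => T x.1 x.2) {z : α → WordCode} (hz : Computable z) :
    REPred fun a => mk (z a) ∈ Subgroup.closure {g | ∃ y, T a y ∧ g = mk y} := by
  simp only [mk_mem_closure_iff]
  refine ex (and (forall_mem (by fun_prop) (or ?_ ?_)) (eq (by fun_prop) (by fun_prop)))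
  · exact hT.comp (g := fun x : (α × List WordCode) × WordCode => (x.1.1, x.2)) (by fun_prop)
  · exact hT.comp (g := fun x : (α × List WordCode) × WordCode => (x.1.1, invRev x.2))
      (by fun_prop)

open FreeGroup in
-- A normal closure is the closure of the conjugates, and each conjugate is written as a word, so
-- the criterion for closures applies.
theorem normalClosure_mk_eq (R : WordCode → Prop) :
    Subgroup.normalClosure {g | ∃ r, R r ∧ g = mk r} =
      Subgroup.closure {g | ∃ y, (∃ r u, R r ∧ y = u ++ r ++ invRev u) ∧ g = mk y} := by
  rw [Subgroup.normalClosure]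
  congr 1
  ext g
  simp only [Group.mem_conjugatesOfSet_iff, Set.mem_ofPred_eq]
  constructor
  · rintro ⟨_, ⟨r, hr, rfl⟩, hg⟩
    obtain ⟨c, rfl⟩ := isConj_iff.1 hg
    refine ⟨_, ⟨r, c.toWord, hr, rfl⟩, ?_⟩
    simp [← mul_mk, ← inv_mk, mk_toWord, mul_assoc]
  · rintro ⟨_, ⟨r, u, hr, rfl⟩, rfl⟩
    exact ⟨_, ⟨r, hr, rfl⟩, isConj_iff.2 ⟨mk u, by simp [← mul_mk, ← inv_mk, mul_assoc]⟩⟩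

open FreeGroup in
theorem REPred.mk_mem_normalClosure {α : Type*} [Primcodable α] {R : α → WordCode → Prop}
    (hR : REPred fun x : α × WordCode => R x.1 x.2) {z : α → WordCode} (hz : Computable z) :
    REPred fun a => mk (z a) ∈ Subgroup.normalClosure {g | ∃ y, R a y ∧ g = mk y} := by
  simp only [normalClosure_mk_eq]
  refine mk_mem_closure (T := fun a y => ∃ r u, R a r ∧ y = u ++ r ++ invRev u) ?_ hz
  refine ex (ex (and ?_ (eq (by fun_prop) (by fun_prop))))
  exact hR.comp (g := fun x : ((α × WordCode) × WordCode) × WordCode => (x.1.1.1, x.1.2))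
    (by fun_prop)

open FreeGroup in
theorem REPred.mk_mem_closure_sup_normalClosure {α : Type*} [Primcodable α]
    {S R : α → WordCode → Prop} (hS : REPred fun x : α × WordCode => S x.1 x.2)
    (hR : REPred fun x : α × WordCode => R x.1 x.2) {z : α → WordCode} (hz : Computable z) :
    REPred fun a => mk (z a) ∈ Subgroup.closure {g | ∃ y, S a y ∧ g = mk y} ⊔
      Subgroup.normalClosure {g | ∃ y, R a y ∧ g = mk y} := by
  have : REPred fun a => mk (z a) ∈ Subgroup.closure {g | ∃ y,
      (S a y ∨ ∃ r u, R a r ∧ y = u ++ r ++ invRev u) ∧ g = mk y} := by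
    refine mk_mem_closure (T := fun a y => S a y ∨ ∃ r u, R a r ∧ y = u ++ r ++ invRev u) ?_ hz
    refine or hS (ex (ex (and ?_ (eq (by fun_prop) (by fun_prop)))))
    exact hR.comp (g := fun x : ((α × WordCode) × WordCode) × WordCode => (x.1.1.1, x.1.2))
      (by fun_prop)
  refine this.of_eq fun a => ?_
  rw [normalClosure_mk_eq, ← Subgroup.closure_union]
  congr! 3
  ext g
  simp only [Set.mem_ofPred_eq, Set.mem_union, or_and_right, exists_or]

/-! ### Evaluating coded words in presented groups -/

theorem WordCode.mk_shift (i : ℕ) (w : WordCode) :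
    FreeGroup.mk (w.shift i) = FreeGroup.map (Nat.pair i) (FreeGroup.mk w) := rfl

theorem WordCode.mk_subst (φ : List WordCode) (w : WordCode) :
    FreeGroup.mk (WordCode.subst φ w) =
      FreeGroup.lift (fun k => FreeGroup.mk (φ.getD k [])) (FreeGroup.mk w) := by
  induction w with
  | nil => rfl
  | cons l w ih =>
    rw [WordCode.subst, List.flatMap_cons, ← FreeGroup.mul_mk]
    change _ * FreeGroup.mk (WordCode.subst φ w) = _
    rw [ih, FreeGroup.lift_mk, FreeGroup.lift_mk, List.map_cons, List.prod_cons]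
    congr 1
    cases l.2 <;> simp [FreeGroup.inv_mk]

theorem GroupWord.mk_code {n : ℕ} (w : GroupWord n) :
    FreeGroup.mk w.code = FreeGroup.map Fin.val (FreeGroup.mk w) := rfl

theorem WordCode.exists_code_eq_clean (n : ℕ) (w : WordCode) :
    ∃ w' : GroupWord n, w'.code = w.clean n := by
  induction w with
  | nil => exact ⟨[], rfl⟩
  | cons l w ih =>
    obtain ⟨w', h⟩ := ih
    by_cases hl : l.1 < n
    · refine ⟨(⟨l.1, hl⟩, l.2) :: w', ?_⟩
      simp only [GroupWord.code, WordCode.clean] at h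
      simp [GroupWord.code, h, WordCode.clean, hl]
    · exact ⟨w', by rw [h]; simp [WordCode.clean, hl]⟩

namespace FinitePresentation

variable (P : FinitePresentation) {K : Type*} [Group K]

/-- The homomorphism from the free group on `ℕ` to the presented group that kills the letters
which are not among the generators. -/
noncomputable def evalHom : FreeGroup ℕ →* P.toGroup :=
  FreeGroup.lift fun k => if h : k < P.numGens then PresentedGroup.of ⟨k, h⟩ else 1

theorem evalHom_map (x : FreeGroup (Fin P.numGens)) :
    P.evalHom (FreeGroup.map Fin.val x) = PresentedGroup.mk P.relatorSet x := by
  have : P.evalHom.comp (FreeGroup.map Fin.val) = PresentedGroup.mk P.relatorSet := by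
    ext k
    simp [evalHom, PresentedGroup.of]
  exact DFunLike.congr_fun this x

theorem evalHom_code (w : GroupWord P.numGens) : P.evalHom (FreeGroup.mk w.code) = P.eval w :=
  P.evalHom_map (FreeGroup.mk w)

theorem exists_eval_eq (g : P.toGroup) : ∃ w, P.eval w = g := by
  obtain ⟨x, rfl⟩ := PresentedGroup.mk_surjective _ g
  exact ⟨x.toWord, by rw [eval, FreeGroup.mk_toWord]⟩

/-- Letters out of range evaluate to `1`, so deleting them is harmless. This allows words over all
of `ℕ` to be fed to an algorithm that is only trusted on words in the generators. -/
theorem evalHom_clean (w : WordCode) :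
    P.evalHom (FreeGroup.mk (w.clean P.numGens)) = P.evalHom (FreeGroup.mk w) := by
  induction w with
  | nil => rfl
  | cons l w ih =>
    rw [WordCode.clean, List.flatMap_cons, ← FreeGroup.mul_mk, map_mul]
    change _ * P.evalHom (FreeGroup.mk (WordCode.clean _ w)) = _
    rw [ih, show l :: w = [l] ++ w from rfl, ← FreeGroup.mul_mk, map_mul]
    congr 1
    split_ifs with h
    · rfl
    · simp [evalHom, h, FreeGroup.lift_mk]

variable {P}

/-- A homomorphism from the free group on `ℕ` that kills the relators descends to the presented
group. -/
def descend (f : FreeGroup ℕ →* K) (hf : ∀ r ∈ P.relators, f (FreeGroup.mk r.code) = 1) :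
    P.toGroup →* K :=
  PresentedGroup.toGroup (f := fun k : Fin P.numGens => f (FreeGroup.of k)) (by
    rintro _ ⟨r, hr, rfl⟩
    rw [← hf r hr, GroupWord.mk_code]
    have : FreeGroup.lift (fun k : Fin P.numGens => f (FreeGroup.of k)) =
        f.comp (FreeGroup.map Fin.val) := by ext; simp
    rw [this]
    rfl)

theorem descend_mk (f : FreeGroup ℕ →* K) (hf : ∀ r ∈ P.relators, f (FreeGroup.mk r.code) = 1)
    (x : FreeGroup (Fin P.numGens)) :
    descend f hf (PresentedGroup.mk _ x) = f (FreeGroup.map Fin.val x) := by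
  have : (descend f hf).comp (PresentedGroup.mk _) = f.comp (FreeGroup.map Fin.val) := by
    ext k
    simp [descend, ← PresentedGroup.of.eq_1]
  exact DFunLike.congr_fun this x

theorem descend_eval (f : FreeGroup ℕ →* K) (hf : ∀ r ∈ P.relators, f (FreeGroup.mk r.code) = 1)
    (w : GroupWord P.numGens) : descend f hf (P.eval w) = f (FreeGroup.mk w.code) :=
  descend_mk f hf _

theorem evalHom_relator {r : GroupWord P.numGens} (hr : r ∈ P.relators) :
    P.evalHom (FreeGroup.mk r.code) = 1 := by
  rw [evalHom_code]
  exact (QuotientGroup.eq_one_iff _).2 (Subgroup.subset_normalClosure ⟨r, hr, rfl⟩)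

/-- Membership in a subgroup of a presented group, expressed in the free group on `ℕ`. -/
theorem eval_mem_closure_iff (ws : List (GroupWord P.numGens)) (z : GroupWord P.numGens) :
    P.eval z ∈ Subgroup.closure {g | ∃ w ∈ ws, g = P.eval w} ↔
      FreeGroup.mk z.code ∈
        Subgroup.closure {g | ∃ y, y ∈ ws.map GroupWord.code ∧ g = FreeGroup.mk y} ⊔
        Subgroup.normalClosure {g | ∃ y, y ∈ P.code.2 ∧ g = FreeGroup.mk y} := by
  constructor
  · intro h
    -- In the quotient by `N` the letters outside the generators remain free, so it is not
    -- `P.toGroup`. The two directions therefore use separate homomorphisms, `descend` into this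
    -- quotient and `evalHom` out of the free group.
    set N := Subgroup.normalClosure {g | ∃ y, y ∈ P.code.2 ∧ g = FreeGroup.mk y}
    have hf : ∀ r ∈ P.relators, QuotientGroup.mk' N (FreeGroup.mk r.code) = 1 := fun r hr =>
      (QuotientGroup.eq_one_iff _).2
        (Subgroup.subset_normalClosure ⟨_, List.mem_map_of_mem hr, rfl⟩)
    have h2 := Subgroup.mem_map_of_mem (descend _ hf) h
    rw [descend_eval, MonoidHom.map_closure] at h2
    have h3 : descend _ hf '' {g | ∃ w ∈ ws, g = P.eval w} = QuotientGroup.mk' N ''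
        {g | ∃ y, y ∈ ws.map GroupWord.code ∧ g = FreeGroup.mk y} := by
      ext g
      constructor
      · rintro ⟨_, ⟨w, hw, rfl⟩, rfl⟩
        exact ⟨_, ⟨_, List.mem_map_of_mem hw, rfl⟩, (descend_eval _ hf w).symm⟩
      · rintro ⟨_, ⟨y, hy, rfl⟩, rfl⟩
        obtain ⟨w, hw, rfl⟩ := List.mem_map.1 hy
        exact ⟨_, ⟨w, hw, rfl⟩, descend_eval _ hf w⟩
    rw [h3, ← MonoidHom.map_closure, ← Subgroup.mem_comap, Subgroup.comap_map_eq,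
      QuotientGroup.ker_mk'] at h2
    exact h2
  · intro h
    rw [← evalHom_code, ← Subgroup.mem_comap]
    refine (sup_le ?_ (le_trans ?_ (MonoidHom.ker_le_comap _ _)) :
      _ ≤ Subgroup.comap P.evalHom _) h
    · rw [Subgroup.closure_le]
      rintro _ ⟨y, hy, rfl⟩
      obtain ⟨w, hw, rfl⟩ := List.mem_map.1 hy
      exact Subgroup.subset_closure ⟨w, hw, P.evalHom_code w⟩
    · refine Subgroup.normalClosure_le_normal ?_
      rintro _ ⟨y, hy, rfl⟩
      obtain ⟨w, hw, rfl⟩ := List.mem_map.1 hy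
      exact evalHom_relator hw

end FinitePresentation

/-- Given a solution of the Membership Problem in `C`, there is one that accepts arbitrary words,
ignoring the letters that are not among the generators. -/
theorem MembershipProblemSolvable.exists_partrec {C : GroupClass.{u}}
    (h : MembershipProblemSolvable C) :
    ∃ f : PresentationCode × List WordCode × WordCode →. Bool, Partrec f ∧
      ∀ P : FinitePresentation, P.PresentsGroupIn C → ∀ (K : List WordCode) (w : WordCode),
        ∃ b ∈ f (P.code, K, w), (b = true ↔ P.evalHom (FreeGroup.mk w) ∈
          Subgroup.closure {g | ∃ y ∈ K, g = P.evalHom (FreeGroup.mk y)}) := by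
  obtain ⟨f, hf, hfC⟩ := h
  refine ⟨fun x => f (x.1, x.2.1.map (WordCode.clean x.1.1), x.2.2.clean x.1.1),
    hf.comp (by fun_prop), fun P hP K w => ?_⟩
  choose g hg using WordCode.exists_code_eq_clean P.numGens
  obtain ⟨b, hb, h⟩ := hfC P hP (K.map g) (g w)
  refine ⟨b, ?_, ?_⟩
  · rw [hg, List.map_map] at hb
    change b ∈ f (_, _, _)
    convert hb using 4
    · exact List.map_congr_left fun a _ => (hg a).symm
    · rfl
  · rw [h, ← P.evalHom_code, hg, P.evalHom_clean]
    congr! 3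
    ext x
    simp only [List.mem_map, exists_exists_and_eq_and, ← P.evalHom_code, hg,
      P.evalHom_clean]

/-! ### Certificates of nonmembership -/

/-- A point of a finite piece of a `G`-set, `G` a presented group: the name of its orbit, words
generating the stabilizer of a base point of the orbit, and a word carrying the base point to the
point. -/
abbrev PointCode : Type := (ℕ × List WordCode) × WordCode

/-- A finite piece, with a given number of points, of a set on which a free product of presented
groups acts: the presentations of the factors, the number of points, and for each factor the list
of its points. -/
abbrev PieceCode : Type := List PresentationCode × ℕ × List (List PointCode)

namespace PieceCode

variable (f : PresentationCode × List WordCode × WordCode →. Bool) (D : PieceCode)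

/-- The presentation of the `i`-th factor. -/
def factor (i : ℕ) : PresentationCode := D.1.getD i (0, [])

/-- The point with number `u`, considered under the action of the `i`-th factor. -/
def point (i u : ℕ) : PointCode := (D.2.2.getD i []).getD u ((0, []), [])

/-- According to `f`, the letter `a` carries the point `u` to the point `v`. -/
def IsEdge (a : ℕ × Bool) (v u : ℕ) : Prop :=
  a.1.unpair.1 < D.1.length ∧ v < D.2.1 ∧ u < D.2.1 ∧
    (D.point a.1.unpair.1 v).1 = (D.point a.1.unpair.1 u).1 ∧
    true ∈ f (D.factor a.1.unpair.1, (D.point a.1.unpair.1 v).1.2,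
      FreeGroup.invRev (D.point a.1.unpair.1 v).2 ++
        (a.1.unpair.2, a.2) :: (D.point a.1.unpair.1 u).2)

/-- According to `f`, the word `w` carries the point `u` to the point `v` inside the piece. -/
def IsPath (w : WordCode) (v u : ℕ) : Prop :=
  ∃ p : List ℕ, p.getD 0 0 = v ∧ p.getD w.length 0 = u ∧
    ∀ j < w.length, D.IsEdge f (w.getD j (0, true)) (p.getD j 0) (p.getD (j + 1) 0)

/-- According to `f`, points with different numbers are different. -/
def IsSeparated : Prop :=
  ∀ i < D.1.length, ∀ u < D.2.1, ∀ v < D.2.1, u = v ∨ (D.point i u).1 ≠ (D.point i v).1 ∨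
    false ∈ f (D.factor i, (D.point i u).1.2,
      FreeGroup.invRev (D.point i u).2 ++ (D.point i v).2)

/-- The relators of the free product of the factors, the letter `k` of the `i`-th factor being
renamed `Nat.pair i k`. -/
def IsRelator (y : WordCode) : Prop :=
  ∃ i < D.1.length, ∃ r ∈ (D.factor i).2, y = WordCode.shift i r

/-- The factors are listed by `L`, the words `φ` define a homomorphism from the group presented by
`x.1` to the free product of the factors, and in the resulting action the words `x.2.1` fix the
point `b` whereas the word `x.2.2` does not. -/
def IsNonmembershipCertificate (L : ℕ → Option PresentationCode)
    (x : PresentationCode × List WordCode × WordCode)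
    (φ : List WordCode) (b : ℕ) : Prop :=
  (∀ i < D.1.length, ∃ t, L t = some (D.factor i)) ∧
  (∀ r ∈ x.1.2, FreeGroup.mk (WordCode.subst φ r) ∈
    Subgroup.normalClosure {g | ∃ y, D.IsRelator y ∧ g = FreeGroup.mk y}) ∧
  D.IsSeparated f ∧ b < D.2.1 ∧ (∀ w ∈ x.2.1, D.IsPath f (WordCode.subst φ w) b b) ∧
  ∃ v, v < D.2.1 ∧ v ≠ b ∧ D.IsPath f (WordCode.subst φ x.2.2) v b

end PieceCode

namespace Computable

variable {α : Type*} [Primcodable α]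

@[fun_prop]
theorem fun_factor {D : α → PieceCode} {i : α → ℕ} (hD : Computable D) (hi : Computable i) :
    Computable fun a => (D a).factor (i a) := by
  unfold PieceCode.factor; fun_prop

@[fun_prop]
theorem fun_point {D : α → PieceCode} {i u : α → ℕ} (hD : Computable D) (hi : Computable i)
    (hu : Computable u) : Computable fun a => (D a).point (i a) (u a) := by
  unfold PieceCode.point; fun_prop

end Computable

namespace PieceCode

variable {f : PresentationCode × List WordCode × WordCode →. Bool} {α : Type*} [Primcodable α]

theorem rePred_isEdge (hf : Partrec f) {D : α → PieceCode} {a : α → ℕ × Bool} {v u : α → ℕ}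
    (hD : Computable D) (ha : Computable a) (hv : Computable v) (hu : Computable u) :
    REPred fun x => (D x).IsEdge f (a x) (v x) (u x) := by
  unfold IsEdge
  refine .and (.lt (by fun_prop) (by fun_prop)) (.and (.lt (by fun_prop) (by fun_prop))
    (.and (.lt (by fun_prop) (by fun_prop)) (.and (.eq (by fun_prop) (by fun_prop)) ?_)))
  exact (REPred.mem_partrec hf (.const true)).comp (by fun_prop)

theorem rePred_isPath (hf : Partrec f) {D : α → PieceCode} {w : α → WordCode} {v u : α → ℕ}
    (hD : Computable D) (hw : Computable w) (hv : Computable v) (hu : Computable u) :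
    REPred fun x => (D x).IsPath f (w x) (v x) (u x) := by
  unfold IsPath
  refine .ex (.and (.eq (by fun_prop) (by fun_prop)) (.and (.eq (by fun_prop) (by fun_prop))
    (.forall_lt (by fun_prop) (rePred_isEdge hf ?_ ?_ ?_ ?_)))) <;> fun_prop

theorem rePred_isSeparated (hf : Partrec f) {D : α → PieceCode} (hD : Computable D) :
    REPred fun x => (D x).IsSeparated f := by
  unfold IsSeparated
  refine .forall_lt (by fun_prop) (.forall_lt (by fun_prop) (.forall_lt (by fun_prop)
    (.or (.eq (by fun_prop) (by fun_prop)) (.or (.ne (by fun_prop) (by fun_prop)) ?_))))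
  exact (REPred.mem_partrec hf (.const false)).comp (by fun_prop)

theorem rePred_isRelator : REPred fun x : PieceCode × WordCode => x.1.IsRelator x.2 := by
  unfold IsRelator
  exact .exists_lt (by fun_prop) (.exists_mem (by fun_prop) (.eq (by fun_prop) (by fun_prop)))

theorem rePred_mk_mem_normalClosure {D : α → PieceCode} {z : α → WordCode} (hD : Computable D)
    (hz : Computable z) : REPred fun x => FreeGroup.mk (z x) ∈
      Subgroup.normalClosure {g | ∃ y, (D x).IsRelator y ∧ g = FreeGroup.mk y} :=
  .mk_mem_normalClosure (R := fun x y => (D x).IsRelator y)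
    (rePred_isRelator.comp (g := fun x : α × WordCode => (D x.1, x.2)) (by fun_prop)) hz

theorem rePred_isNonmembershipCertificate (hf : Partrec f) {L : ℕ → Option PresentationCode}
    (hL : Computable L) {D : α → PieceCode} {x : α → PresentationCode × List WordCode × WordCode}
    {φ : α → List WordCode} {b : α → ℕ} (hD : Computable D) (hx : Computable x)
    (hφ : Computable φ) (hb : Computable b) :
    REPred fun a => (D a).IsNonmembershipCertificate f L (x a) (φ a) (b a) := by
  refine .and ?_ (.and ?_ (.and (rePred_isSeparated hf hD) (.and ?_ (.and ?_ ?_))))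
  · exact .forall_lt (by fun_prop) (.ex (.eq (by fun_prop) (by fun_prop)))
  · exact .forall_mem (by fun_prop) (rePred_mk_mem_normalClosure (by fun_prop) (by fun_prop))
  · exact .lt (by fun_prop) (by fun_prop)
  · refine .forall_mem (by fun_prop) (rePred_isPath hf ?_ ?_ ?_ ?_) <;> fun_prop
  · refine .ex (.and (.lt (by fun_prop) (by fun_prop)) (.and (.ne (by fun_prop) (by fun_prop))
      (rePred_isPath hf ?_ ?_ ?_ ?_))) <;> fun_prop

end PieceCode

/-! ### Soundness of certificates -/

open Pointwise

/-- Actions of several groups on sets with a common subset can be extended to actions on one set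
containing that subset. -/
theorem exists_common_action {ι V : Type*} {G : ι → Type*} [∀ i, Group (G i)] {Y : ι → Type*}
    [∀ i, MulAction (G i) (Y i)] (e : ∀ i, V ↪ Y i) :
    ∃ ρ : ∀ i, G i →* Equiv.Perm (V ⊕ Σ i, Y i),
      ∀ i (g : G i) u v, g • e i u = e i v → ρ i g (Sum.inl u) = Sum.inl v := by
  classical
  -- Points of `Y i` coming from `V` go to the shared copy of `V`, all others to a private summand.
  let j (i : ι) : Y i ↪ V ⊕ Σ i, Y i :=
    { toFun := fun y => if h : ∃ v, e i v = y then .inl h.choose else .inr ⟨i, y⟩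
      inj' := by
        intro x y hxy
        by_cases hx : ∃ v, e i v = x <;> by_cases hy : ∃ v, e i v = y
        · simp only [hx, hy, dite_true, Sum.inl.injEq] at hxy
          rw [← hx.choose_spec, ← hy.choose_spec, hxy]
        · simp [hx, hy] at hxy
        · simp [hx, hy] at hxy
        · simpa [hx, hy] using hxy }
  have hj : ∀ i v, j i (e i v) = Sum.inl v := by
    intro i v
    have h : ∃ v', e i v' = e i v := ⟨v, rfl⟩
    change dite _ _ _ = _
    rw [dif_pos h]
    exact congrArg _ ((e i).injective h.choose_spec)
  -- Transported along `j i`, the action of `G i` is the identity outside the image of `Y i`.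
  refine ⟨fun i => (Equiv.Perm.viaEmbeddingHom (j i)).comp (MulAction.toPermHom (G i) (Y i)),
    fun i g u v h => ?_⟩
  rw [MonoidHom.comp_apply, Equiv.Perm.viaEmbeddingHom_apply, ← hj i u,
    Equiv.Perm.viaEmbedding_apply, MulAction.toPermHom_apply, MulAction.toPerm_apply, h, hj]

namespace PieceCode

variable {f : PresentationCode × List WordCode × WordCode →. Bool} {C : GroupClass.{u}}
  {D : PieceCode}

/-- Words act on the left, so the last letter acts first: the list of points starts at the target
`v` and ends at the source `u`. -/
theorem apply_eq_of_isPath {X : Type*} {A : FreeGroup ℕ →* Equiv.Perm X} {j : ℕ → X}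
    (hA : ∀ a v u, D.IsEdge f a v u → A (FreeGroup.mk [a]) (j u) = j v) {w : WordCode} {v u : ℕ}
    (h : D.IsPath f w v u) : A (FreeGroup.mk w) (j u) = j v := by
  obtain ⟨p, rfl, rfl, hp⟩ := h
  induction w generalizing p with
  | nil => simp [← FreeGroup.one_eq_mk]
  | cons a w ih =>
    have h1 := hA _ _ _ (hp 0 (by simp))
    have h2 := ih p.tail fun k hk => by
      simpa [List.getD_eq_getElem?_getD] using hp (k + 1) (by simpa using hk)
    rw [show a :: w = [a] ++ w from rfl, ← FreeGroup.mul_mk, map_mul, Equiv.Perm.mul_apply]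
    have h3 : p.tail.getD w.length 0 = p.getD ([a] ++ w).length 0 := by
      simp [List.getD_eq_getElem?_getD]
    have h4 : p.tail.getD 0 0 = p.getD (0 + 1) 0 := by
      simp [List.getD_eq_getElem?_getD]
    rw [h3, h4] at h2
    rw [h2]
    exact h1

/-- A nonmembership certificate is sound. -/
theorem IsNonmembershipCertificate.notMem {L : ℕ → Option PresentationCode}
    (hf : ∀ P : FinitePresentation, P.PresentsGroupIn C → ∀ (K : List WordCode) (w : WordCode),
        ∃ b ∈ f (P.code, K, w), (b = true ↔ P.evalHom (FreeGroup.mk w) ∈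
          Subgroup.closure {g | ∃ y ∈ K, g = P.evalHom (FreeGroup.mk y)}))
    (hL : ∀ t c, L t = some c → ∃ P : FinitePresentation, P.code = c ∧ P.PresentsGroupIn C)
    {P : FinitePresentation} {ws : List (GroupWord P.numGens)} {z : GroupWord P.numGens}
    {φ : List WordCode} {b : ℕ}
    (h : D.IsNonmembershipCertificate f L (P.code, ws.map GroupWord.code, z.code) φ b) :
    P.eval z ∉ Subgroup.closure {g | ∃ w ∈ ws, g = P.eval w} := by
  obtain ⟨h1, h2, h3, hb, h4, v, hv, hvb, h5⟩ := h
  have hQ : ∀ i : Fin D.1.length, ∃ Q : FinitePresentation,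
      Q.code = D.factor i ∧ Q.PresentsGroupIn C := by
    intro i
    obtain ⟨t, ht⟩ := h1 i i.2
    exact hL _ _ ht
  choose Q hQ hQC using hQ
  -- A listed factor presents a group in `C`, where `f` has a correct value; values being unique,
  -- whatever `f` returns is that one.
  have hmem : ∀ (i : Fin D.1.length) (K : List WordCode) (w : WordCode) (b : Bool),
      b ∈ f (D.factor i, K, w) → (b = true ↔ (Q i).evalHom (FreeGroup.mk w) ∈
        Subgroup.closure {g | ∃ y ∈ K, g = (Q i).evalHom (FreeGroup.mk y)}) := by
    intro i K w b hb
    obtain ⟨b', hb', h⟩ := hf (Q i) (hQC i) K w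
    rw [hQ] at hb'
    rwa [Part.mem_unique hb hb']
  let S (i : Fin D.1.length) (K : List WordCode) : Subgroup (Q i).toGroup :=
    Subgroup.closure {g | ∃ y ∈ K, g = (Q i).evalHom (FreeGroup.mk y)}
  -- The point `u` becomes a left coset tagged by its orbit name and generating words. Cosets are
  -- kept as sets, so one translation action serves all subgroups; separation of the piece gives
  -- injectivity.
  let e (i : Fin D.1.length) : Fin D.2.1 ↪ Σ _ : ℕ × List WordCode, Set (Q i).toGroup :=
    { toFun := fun u => ⟨(D.point i u).1,
        (Q i).evalHom (FreeGroup.mk (D.point i u).2) • (S i (D.point i u).1.2 : Set (Q i).toGroup)⟩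
      inj' := by
        intro u v huv
        rcases h3 i i.2 u u.2 v v.2 with h | h | h
        · exact Fin.ext h
        · exact absurd (congrArg Sigma.fst huv) h
        · exfalso
          have hτ := congrArg Sigma.fst huv
          dsimp only at huv hτ
          rw [hτ, Sigma.mk.injEq] at huv
          have h6 := eq_of_heq huv.2
          rw [leftCoset_eq_iff] at h6
          have h7 := hmem i _ _ _ h
          rw [← FreeGroup.mul_mk, ← FreeGroup.inv_mk, map_mul, map_inv, hτ] at h7
          exact Bool.false_ne_true (h7.2 h6) }
  obtain ⟨ρ, hρ⟩ := exists_common_action (G := fun i => (Q i).toGroup) e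
  let A : FreeGroup ℕ →* Equiv.Perm (Fin D.2.1 ⊕ Σ i : Fin D.1.length,
      Σ _ : ℕ × List WordCode, Set (Q i).toGroup) :=
    FreeGroup.lift fun m => if h : m.unpair.1 < D.1.length then
      ρ ⟨_, h⟩ ((Q ⟨_, h⟩).evalHom (FreeGroup.of m.unpair.2)) else 1
  have hA : ∀ (i : Fin D.1.length) x,
      A (FreeGroup.map (Nat.pair i) x) = ρ i ((Q i).evalHom x) := by
    intro i x
    have : A.comp (FreeGroup.map (Nat.pair i)) = (ρ i).comp (Q i).evalHom := by
      ext1 k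
      simp only [A, MonoidHom.comp_apply, FreeGroup.map.of, FreeGroup.lift_apply_of]
      -- Generalizing the index `(Nat.pair i k).unpair.1` to `m` avoids transport in the dependent
      -- family `Q`.
      have h : ∀ (m : ℕ) (hm : m < D.1.length), m = i →
          ρ ⟨m, hm⟩ ((Q ⟨m, hm⟩).evalHom (FreeGroup.of k)) =
            ρ i ((Q i).evalHom (FreeGroup.of k)) := by
        rintro m hm rfl
        rfl
      simpa using h _ (by simp) (by simp)
    exact DFunLike.congr_fun this x
  have hedge : ∀ a (v u : ℕ), D.IsEdge f a v u → ∃ (hv : v < D.2.1) (hu : u < D.2.1),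
      A (FreeGroup.mk [a]) (Sum.inl ⟨u, hu⟩) = Sum.inl ⟨v, hv⟩ := by
    rintro ⟨m, s⟩ v u ⟨hm, hv, hu, hτ, hvu⟩
    refine ⟨hv, hu, ?_⟩
    dsimp only at hm hτ hvu
    have h6 := (hmem ⟨_, hm⟩ _ _ _ hvu).1 rfl
    have h7 : FreeGroup.mk [(m, s)] =
        FreeGroup.map (Nat.pair m.unpair.1) (FreeGroup.mk [(m.unpair.2, s)]) := by
      simp [FreeGroup.map.mk]
    rw [h7]
    rw [hA ⟨_, hm⟩]
    apply hρ
    refine Sigma.ext hτ.symm (heq_of_eq ?_)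
    change _ • _ • _ = _ • _
    rw [smul_smul, eq_comm, hτ, leftCoset_eq_iff]
    rw [← FreeGroup.mul_mk, ← List.singleton_append, ← FreeGroup.mul_mk, ← FreeGroup.inv_mk,
      map_mul, map_mul, map_inv, hτ] at h6
    exact h6
  -- The value at numbers out of range is arbitrary, since edges only join points in range.
  let j (u : ℕ) : Fin D.2.1 ⊕ Σ i : Fin D.1.length, Σ _ : ℕ × List WordCode,
      Set (Q i).toGroup := if hu : u < D.2.1 then Sum.inl ⟨u, hu⟩ else Sum.inl ⟨b, hb⟩
  have hpath : ∀ {w v u}, D.IsPath f w v u → A (FreeGroup.mk w) (j u) = j v := by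
    refine apply_eq_of_isPath fun a v u hvu => ?_
    obtain ⟨hv, hu, h⟩ := hedge a v u hvu
    simpa [j, hv, hu] using h
  let B : P.toGroup →* Equiv.Perm (Fin D.2.1 ⊕ Σ i : Fin D.1.length,
      Σ _ : ℕ × List WordCode, Set (Q i).toGroup) :=
    FinitePresentation.descend
      (A.comp (FreeGroup.lift fun k => FreeGroup.mk (φ.getD k []))) (by
        intro r hr
        rw [MonoidHom.comp_apply, ← WordCode.mk_subst, ← MonoidHom.mem_ker]
        refine Subgroup.normalClosure_le_normal ?_ (h2 _ (List.mem_map_of_mem hr))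
        rintro _ ⟨_, ⟨i, hi, r, hr, rfl⟩, rfl⟩
        rw [SetLike.mem_coe, MonoidHom.mem_ker, WordCode.mk_shift, hA ⟨i, hi⟩]
        rw [← hQ ⟨i, hi⟩] at hr
        obtain ⟨r', hr', rfl⟩ := List.mem_map.1 hr
        rw [FinitePresentation.evalHom_relator hr', map_one])
  have hB : ∀ w : GroupWord P.numGens,
      B (P.eval w) = A (FreeGroup.mk (WordCode.subst φ w.code)) := by
    intro w
    rw [WordCode.mk_subst]
    exact FinitePresentation.descend_eval _ _ w
  intro hz
  have hstab : Subgroup.closure {g | ∃ w ∈ ws, g = P.eval w} ≤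
      (MulAction.stabilizer (Equiv.Perm (Fin D.2.1 ⊕ Σ i : Fin D.1.length,
        Σ _ : ℕ × List WordCode, Set (Q i).toGroup)) (j b)).comap B := by
    rw [Subgroup.closure_le]
    rintro _ ⟨w, hw, rfl⟩
    rw [SetLike.mem_coe, Subgroup.mem_comap, MulAction.mem_stabilizer_iff, hB]
    exact hpath (h4 _ (List.mem_map_of_mem hw))
  have h6 := hstab hz
  rw [Subgroup.mem_comap, MulAction.mem_stabilizer_iff, hB, Equiv.Perm.smul_def,
    hpath h5] at h6
  simp [j, hv, hb, hvb] at h6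

end PieceCode

/-! ### Completeness of certificates -/

/-- A finite subset of a set acted on by a presented group is described by finitely many words, in
such a way that the action of given words inside the subset is recorded. -/
theorem exists_pointCodes {Q : FinitePresentation} {X : Type*} (ρ : Q.toGroup →* Equiv.Perm X)
    {N : ℕ} (pt : Fin N → X) (hpt : Function.Injective pt) (Λ : List (ℕ × Bool)) :
    ∃ T : Fin N → PointCode,
      (∀ u v, u ≠ v → (T u).1 = (T v).1 →
        Q.evalHom (FreeGroup.mk (FreeGroup.invRev (T u).2 ++ (T v).2)) ∉
          Subgroup.closure {g | ∃ y ∈ (T u).1.2, g = Q.evalHom (FreeGroup.mk y)}) ∧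
      ∀ u v, ∀ a ∈ Λ, ρ (Q.evalHom (FreeGroup.mk [a])) (pt u) = pt v → (T v).1 = (T u).1 ∧
        Q.evalHom (FreeGroup.mk (FreeGroup.invRev (T v).2 ++ a :: (T u).2)) ∈
          Subgroup.closure {g | ∃ y ∈ (T v).1.2, g = Q.evalHom (FreeGroup.mk y)} := by
  classical
  let s : Setoid (Fin N) :=
    { r := fun u v => ∃ g, ρ g (pt u) = pt v
      iseqv :=
        { refl := fun u => ⟨1, by simp⟩
          symm := by
            rintro u v ⟨g, hg⟩
            exact ⟨g⁻¹, by rw [← hg, map_inv]; simp⟩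
          trans := by
            rintro u v w ⟨g, hg⟩ ⟨h, hh⟩
            exact ⟨h * g, by rw [map_mul, Equiv.Perm.mul_apply, hg, hh]⟩ } }
  let rep (u : Fin N) : Fin N := (Quotient.mk s u).out
  have hrep : ∀ u v, (∃ g, ρ g (pt u) = pt v) → rep u = rep v := fun u v h =>
    congrArg Quotient.out (Quotient.sound (s := s) h)
  have hg : ∀ u, ∃ w : WordCode, ρ (Q.evalHom (FreeGroup.mk w)) (pt (rep u)) = pt u := by
    intro u
    obtain ⟨g, hg⟩ : ∃ g, ρ g (pt (rep u)) = pt u := Quotient.mk_out (s := s) u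
    obtain ⟨w, rfl⟩ := Q.exists_eval_eq g
    exact ⟨w.code, by rw [Q.evalHom_code, hg]⟩
  choose g hg using hg
  -- One generator `g_v⁻¹ a g_u` for each observed step `u → v` in the orbit of `r`. Edges then hold
  -- by construction, while `hfix` below keeps the points separated.
  have hK : ∀ r : Fin N, ∃ K : List WordCode, ∀ y, y ∈ K ↔ ∃ u v, ∃ a ∈ Λ, rep u = r ∧
      ρ (Q.evalHom (FreeGroup.mk [a])) (pt u) = pt v ∧ y = FreeGroup.invRev (g v) ++ a :: g u := by
    intro r
    have hfin : {y | ∃ u v, ∃ a ∈ Λ, rep u = r ∧ ρ (Q.evalHom (FreeGroup.mk [a])) (pt u) = pt v ∧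
        y = FreeGroup.invRev (g v) ++ a :: g u}.Finite := by
      refine Set.Finite.subset (s := Set.range fun x : Fin N × Fin N × {a // a ∈ Λ} =>
        FreeGroup.invRev (g x.2.1) ++ x.2.2.1 :: g x.1) (Set.finite_range _) ?_
      rintro _ ⟨u, v, a, ha, -, -, rfl⟩
      exact ⟨⟨u, v, a, ha⟩, rfl⟩
    exact ⟨hfin.toFinset.toList, fun y => by simp⟩
  choose K hK using hK
  have hfix : ∀ r, Subgroup.closure {h | ∃ y ∈ K r, h = Q.evalHom (FreeGroup.mk y)} ≤
      (MulAction.stabilizer (Equiv.Perm X) (pt r)).comap ρ := by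
    intro r
    rw [Subgroup.closure_le]
    rintro _ ⟨y, hy, rfl⟩
    obtain ⟨u, v, a, -, rfl, huv, rfl⟩ := (hK r y).1 hy
    rw [SetLike.mem_coe, Subgroup.mem_comap, MulAction.mem_stabilizer_iff, Equiv.Perm.smul_def,
      ← FreeGroup.mul_mk, ← List.singleton_append, ← FreeGroup.mul_mk, ← FreeGroup.inv_mk]
    simp only [map_mul, map_inv, Equiv.Perm.mul_apply]
    rw [hg, huv, Equiv.Perm.inv_eq_iff_eq, hrep u v ⟨_, huv⟩, hg]
  refine ⟨fun u => ((rep u, K (rep u)), g u), fun u v huv hτ hmem => huv (hpt ?_), ?_⟩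
  · have hr : rep u = rep v := Fin.ext (congrArg (fun x => x.1) hτ)
    have h1 := hfix _ hmem
    rw [Subgroup.mem_comap, MulAction.mem_stabilizer_iff, Equiv.Perm.smul_def,
      ← FreeGroup.mul_mk, ← FreeGroup.inv_mk, map_mul, map_mul, map_inv, map_inv,
      Equiv.Perm.mul_apply, Equiv.Perm.inv_eq_iff_eq, hg, hr, hg] at h1
    exact h1.symm
  · intro u v a ha huv
    have hr := hrep u v ⟨_, huv⟩
    refine ⟨by simp only [hr], Subgroup.subset_closure ⟨_, ?_, rfl⟩⟩
    exact (hK _ _).2 ⟨u, v, a, ha, hr, huv, rfl⟩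

/-- A presentation of a free product of groups in a recursively enumerable class embeds into a free
product of listed presentations by a homomorphism given by a list of words. -/
theorem exists_words_of_presentsGroupIn_freeProduct {C : GroupClass.{u}}
    {L : ℕ → Option PresentationCode}
    (hL : ∀ (G : Type u) [Group G], C G →
      ∃ (t : ℕ) (P : FinitePresentation), L t = some P.code ∧ Nonempty (G ≃* P.toGroup))
    {P : FinitePresentation} (hP : P.PresentsGroupIn (FiniteFreeProductClass C)) :
    ∃ (n : ℕ) (Q : Fin n → FinitePresentation) (M : Type u) (_ : Group M) (Ψ : P.toGroup →* M)
      (inc : ∀ i, (Q i).toGroup →* M) (π : FreeGroup ℕ →* M) (φ : List WordCode),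
      (∀ i, ∃ t, L t = some (Q i).code) ∧ Function.Injective Ψ ∧
      (∀ (i : Fin n) x, π (FreeGroup.map (Nat.pair i) x) = inc i ((Q i).evalHom x)) ∧
      (∀ y ∈ φ, ∀ a ∈ y, a.1.unpair.1 < n) ∧
      (∀ w : GroupWord P.numGens, π (FreeGroup.mk (WordCode.subst φ w.code)) = Ψ (P.eval w)) ∧
      ∀ r ∈ P.relators, FreeGroup.mk (WordCode.subst φ r.code) ∈ Subgroup.normalClosure
        {g | ∃ y, (∃ i, ∃ r ∈ (Q i).relators, y = WordCode.shift i r.code) ∧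
          g = FreeGroup.mk y} := by
  classical
  obtain ⟨G, _, ⟨n, H, _, hH, ⟨e₁⟩⟩, ⟨e₂⟩⟩ := hP
  choose t Q ht e using fun i => hL (H i) (hH i)
  replace e := fun i => (e i).some
  let inc (i : Fin n) : (Q i).toGroup →* Monoid.CoprodI H :=
    Monoid.CoprodI.of.comp (e i).symm.toMonoidHom
  let π : FreeGroup ℕ →* Monoid.CoprodI H := FreeGroup.lift fun m =>
    if h : m.unpair.1 < n then inc ⟨_, h⟩ ((Q ⟨_, h⟩).evalHom (FreeGroup.of m.unpair.2)) else 1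
  have hπ : ∀ (i : Fin n) x, π (FreeGroup.map (Nat.pair i) x) = inc i ((Q i).evalHom x) := by
    intro i x
    have : π.comp (FreeGroup.map (Nat.pair i)) = (inc i).comp (Q i).evalHom := by
      ext1 k
      simp only [π, MonoidHom.comp_apply, FreeGroup.map.of, FreeGroup.lift_apply_of]
      have h : ∀ (m : ℕ) (hm : m < n), m = i →
          inc ⟨m, hm⟩ ((Q ⟨m, hm⟩).evalHom (FreeGroup.of k)) =
            inc i ((Q i).evalHom (FreeGroup.of k)) := by
        rintro m hm rfl
        rfl
      simpa using h _ (by simp) (by simp)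
    exact DFunLike.congr_fun this x
  set N := Subgroup.normalClosure {g | ∃ y, (∃ i, ∃ r ∈ (Q i).relators,
    y = WordCode.shift i r.code) ∧ g = FreeGroup.mk y}
  have hN : ∀ (i : Fin n), ∀ r ∈ (Q i).relators,
      (QuotientGroup.mk' N).comp (FreeGroup.map (Nat.pair i)) (FreeGroup.mk r.code) = 1 :=
    fun i r hr => (QuotientGroup.eq_one_iff _).2
      (Subgroup.subset_normalClosure ⟨_, ⟨i, r, hr, rfl⟩, rfl⟩)
  -- Soundness asks for relators to be sent into `N` itself; `θ` shows this without computing the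
  -- kernel of `π`.
  let θ : Monoid.CoprodI H →* FreeGroup ℕ ⧸ N := Monoid.CoprodI.lift fun i =>
    (FinitePresentation.descend _ (hN i)).comp (e i).toMonoidHom
  -- The same word must represent `m` both through `π` and through `θ`, so it is built by induction
  -- on `m`.
  have key : ∀ m, ∃ w : WordCode, (∀ a ∈ w, a.1.unpair.1 < n) ∧ π (FreeGroup.mk w) = m ∧
      θ m = QuotientGroup.mk' N (FreeGroup.mk w) := by
    intro m
    induction m using Monoid.CoprodI.induction_on with
    | one => exact ⟨[], by simp, map_one π, map_one θ⟩
    | mul x y hx hy =>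
      obtain ⟨v, hv, hv1, hv2⟩ := hx
      obtain ⟨w, hw, hw1, hw2⟩ := hy
      refine ⟨v ++ w, by grind, ?_, ?_⟩
      · rw [← FreeGroup.mul_mk, map_mul, hv1, hw1]
      · rw [← FreeGroup.mul_mk, map_mul, map_mul, hv2, hw2]
    | of i h =>
      obtain ⟨w, hw⟩ := (Q i).exists_eval_eq (e i h)
      refine ⟨WordCode.shift i w.code, ?_, ?_, ?_⟩
      · intro a ha
        obtain ⟨l, -, rfl⟩ := List.mem_map.1 ha
        simp
      · rw [WordCode.mk_shift, hπ, FinitePresentation.evalHom_code, hw]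
        simp [inc]
      · simp only [θ, Monoid.CoprodI.lift_of, MonoidHom.comp_apply, MulEquiv.coe_toMonoidHom]
        rw [← hw, FinitePresentation.descend_eval]
        rfl
  let Ψ : P.toGroup ≃* Monoid.CoprodI H := e₂.trans e₁
  choose ω hω1 hω2 hω3 using fun k : Fin P.numGens => key (Ψ (PresentedGroup.of k))
  let φ : List WordCode := List.ofFn ω
  have hφ : ∀ k : Fin P.numGens, φ.getD k [] = ω k := by
    intro k
    simp [φ, List.getD_eq_getElem?_getD]
  have hσ : ∀ w : GroupWord P.numGens, FreeGroup.mk (WordCode.subst φ w.code) =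
      FreeGroup.lift (fun k => FreeGroup.mk (ω k)) (FreeGroup.mk w) := by
    intro w
    rw [WordCode.mk_subst, GroupWord.mk_code]
    have : (FreeGroup.lift fun k => FreeGroup.mk (φ.getD k [])).comp (FreeGroup.map Fin.val) =
        FreeGroup.lift (fun k => FreeGroup.mk (ω k)) := by
      ext1 k
      simp only [MonoidHom.comp_apply, FreeGroup.map.of, FreeGroup.lift_apply_of, hφ]
    exact DFunLike.congr_fun this (FreeGroup.mk w)
  refine ⟨n, Q, Monoid.CoprodI H, inferInstance, Ψ.toMonoidHom, inc, π, φ, fun i => ⟨_, ht i⟩,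
    Ψ.injective, hπ, ?_, ?_, ?_⟩
  · intro y hy
    obtain ⟨k, rfl⟩ := (List.mem_ofFn' _ _).1 hy
    exact hω1 k
  · intro w
    have : π.comp (FreeGroup.lift fun k => FreeGroup.mk (ω k)) =
        Ψ.toMonoidHom.comp (PresentedGroup.mk P.relatorSet) := by
      ext1 k
      simp only [MonoidHom.comp_apply, FreeGroup.lift_apply_of, hω2]
      rfl
    rw [hσ]
    exact DFunLike.congr_fun this _
  · intro r hr
    have : (QuotientGroup.mk' N).comp (FreeGroup.lift fun k => FreeGroup.mk (ω k)) =
        (θ.comp Ψ.toMonoidHom).comp (PresentedGroup.mk P.relatorSet) := by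
      ext1 k
      simp only [MonoidHom.comp_apply, FreeGroup.lift_apply_of, ← hω3]
      rfl
    change _ ∈ N
    rw [hσ, ← QuotientGroup.ker_mk' N, MonoidHom.mem_ker, ← MonoidHom.comp_apply, this,
      MonoidHom.comp_apply]
    have : PresentedGroup.mk P.relatorSet (FreeGroup.mk r) = 1 :=
      (QuotientGroup.eq_one_iff _).2 (Subgroup.subset_normalClosure ⟨r, hr, rfl⟩)
    rw [this, map_one]

theorem WordCode.unpair_lt_of_mem_subst {n : ℕ} {φ : List WordCode}
    (hφ : ∀ y ∈ φ, ∀ a ∈ y, a.1.unpair.1 < n) (w : WordCode) :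
    ∀ a ∈ WordCode.subst φ w, a.1.unpair.1 < n := by
  have h : ∀ k, ∀ a ∈ φ.getD k [], a.1.unpair.1 < n := by
    intro k
    rw [List.getD_eq_getElem?_getD]
    rcases hk : φ[k]? with _ | y
    · simp
    · exact hφ y (List.mem_of_getElem? hk)
  intro a ha
  obtain ⟨l, -, hl⟩ := List.mem_flatMap.1 ha
  cases hs : l.2
  · rw [hs, cond_false, FreeGroup.invRev, List.mem_reverse, List.mem_map] at hl
    obtain ⟨b, hb, rfl⟩ := hl
    exact h _ b hb
  · rw [hs, cond_true] at hl
    exact h _ a hl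

theorem List.getD_ofFn {α : Type*} {n : ℕ} (F : Fin n → α) (d : α) {i : ℕ} (hi : i < n) :
    (List.ofFn F).getD i d = F ⟨i, hi⟩ := by
  simp [List.getD_eq_getElem?_getD, hi]

theorem GroupWord.code_injective {n : ℕ} : Function.Injective (GroupWord.code (n := n)) :=
  List.map_injective_iff.2 fun _ _ h => Prod.ext (Fin.ext (congrArg Prod.fst h))
    (congrArg (fun x : ℕ × Bool => x.2) h)

theorem FinitePresentation.code_injective : Function.Injective FinitePresentation.code := by
  rintro ⟨n, R⟩ ⟨m, S⟩ h
  obtain rfl : n = m := congrArg Prod.fst h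
  exact congrArg _ (List.map_injective_iff.2 GroupWord.code_injective (congrArg Prod.snd h))

namespace PieceCode

variable {f : PresentationCode × List WordCode × WordCode →. Bool}

/-- The point reached while reading `w` from the right depends only on the suffix read so far, so
the `j`-th vertex is the index of `w.drop j`. -/
theorem isPath_of_index {D : PieceCode} (idx : WordCode → ℕ) {w : WordCode}
    (h : ∀ a s, a :: s <:+ w → D.IsEdge f a (idx (a :: s)) (idx s)) :
    D.IsPath f w (idx w) (idx []) := by
  have hp : ∀ j ≤ w.length, ((List.range (w.length + 1)).map fun j => idx (w.drop j)).getD j 0 =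
      idx (w.drop j) := by
    intro j hj
    simp [List.getD_eq_getElem?_getD, Nat.lt_succ_of_le hj]
  refine ⟨(List.range (w.length + 1)).map fun j => idx (w.drop j), ?_, ?_, ?_⟩
  · rw [hp _ (Nat.zero_le _), List.drop_zero]
  · rw [hp _ le_rfl, List.drop_length]
  · intro j hj
    rw [hp _ hj.le, hp _ hj, List.drop_eq_getElem_cons hj, List.getD_eq_getElem _ _ hj]
    apply h
    rw [← List.drop_eq_getElem_cons hj]
    exact List.drop_suffix _ _

/-- Nonmembership in a free product is witnessed by a certificate. -/
theorem exists_isNonmembershipCertificate {C : GroupClass.{u}}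
    {L : ℕ → Option PresentationCode}
    (hf : ∀ P : FinitePresentation, P.PresentsGroupIn C → ∀ (K : List WordCode) (w : WordCode),
        ∃ b ∈ f (P.code, K, w), (b = true ↔ P.evalHom (FreeGroup.mk w) ∈
          Subgroup.closure {g | ∃ y ∈ K, g = P.evalHom (FreeGroup.mk y)}))
    (hL : ∀ t c, L t = some c → ∃ P : FinitePresentation, P.code = c ∧ P.PresentsGroupIn C)
    (hLC : ∀ (G : Type u) [Group G], C G →
      ∃ (t : ℕ) (P : FinitePresentation), L t = some P.code ∧ Nonempty (G ≃* P.toGroup))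
    {P : FinitePresentation} (hP : P.PresentsGroupIn (FiniteFreeProductClass C))
    {ws : List (GroupWord P.numGens)} {z : GroupWord P.numGens}
    (hz : P.eval z ∉ Subgroup.closure {g | ∃ w ∈ ws, g = P.eval w}) :
    ∃ (D : PieceCode) (φ : List WordCode) (b : ℕ),
      D.IsNonmembershipCertificate f L (P.code, ws.map GroupWord.code, z.code) φ b := by
  classical
  obtain ⟨n, Q, M, _, Ψ, inc, π, φ, hQL, hΨ, hπ, hφ, hφΨ, hrel⟩ :=
    exists_words_of_presentsGroupIn_freeProduct hLC hP
  have hQ : ∀ i (K : List WordCode) (w : WordCode), ∃ b ∈ f ((Q i).code, K, w),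
      (b = true ↔ (Q i).evalHom (FreeGroup.mk w) ∈
        Subgroup.closure {g | ∃ y ∈ K, g = (Q i).evalHom (FreeGroup.mk y)}) := by
    intro i K w
    obtain ⟨t, ht⟩ := hQL i
    obtain ⟨Q', hQ', hQC⟩ := hL _ _ ht
    obtain ⟨b, hb, h⟩ := hf Q' hQC K w
    -- The presentation known to lie in `C` and the one found for the factor share a listed code,
    -- hence coincide.
    obtain rfl : Q' = Q i := FinitePresentation.code_injective hQ'
    exact ⟨b, hb, h⟩
  let S : Subgroup M := (Subgroup.closure {g | ∃ w ∈ ws, g = P.eval w}).map Ψ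
  let ρ : M →* Equiv.Perm (M ⧸ S) := MulAction.toPermHom M (M ⧸ S)
  let x₀ : M ⧸ S := QuotientGroup.mk 1
  let W : List WordCode := (z.code :: ws.map GroupWord.code).map (WordCode.subst φ)
  let pos (s : WordCode) : M ⧸ S := ρ (π (FreeGroup.mk s)) x₀
  have hpos : ∀ w : GroupWord P.numGens,
      pos (WordCode.subst φ w.code) = x₀ ↔
        P.eval w ∈ Subgroup.closure {g | ∃ w ∈ ws, g = P.eval w} := by
    intro w
    change QuotientGroup.mk (π (FreeGroup.mk (WordCode.subst φ w.code)) * 1) = QuotientGroup.mk 1 ↔ _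
    rw [mul_one, eq_comm, QuotientGroup.eq, inv_one, one_mul, hφΨ]
    exact Subgroup.mem_map_iff_mem hΨ
  have hpos_nil : pos [] = x₀ := by
    change ρ (π 1) x₀ = x₀
    simp
  -- All cosets visited while reading the words of `W` from the base point.
  let F : Finset (M ⧸ S) := ((W.flatMap List.tails).map pos).toFinset
  have hF : ∀ w ∈ W, ∀ s, s <:+ w → pos s ∈ F := by
    intro w hw s hs
    simp only [F, List.mem_toFinset, List.mem_map, List.mem_flatMap, List.mem_tails]
    exact ⟨s, ⟨w, hw, hs⟩, rfl⟩
  let pt : Fin F.card → M ⧸ S := fun u => (F.equivFin.symm u : M ⧸ S)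
  have hpt : Function.Injective pt := fun u v h => F.equivFin.symm.injective (Subtype.ext h)
  have hx₀ : x₀ ∈ F := hpos_nil ▸ hF _ List.mem_cons_self _ (List.nil_suffix)
  -- Words leading outside `F` get the index of `x₀` as a default, making `idx` total.
  have hidx : ∀ s, ∃ u, pos s ∈ F → pt u = pos s := fun s =>
    if hs : pos s ∈ F then ⟨F.equivFin ⟨_, hs⟩, fun _ => by simp [pt]⟩
    else ⟨F.equivFin ⟨_, hx₀⟩, fun h => absurd h hs⟩
  choose idx hidx using hidx
  choose T hT1 hT2 using fun i => exists_pointCodes (ρ.comp (inc i)) pt hpt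
    (W.flatten.map fun a => (a.1.unpair.2, a.2))
  let D : PieceCode := (List.ofFn fun i => (Q i).code, F.card,
    List.ofFn fun i => List.ofFn (T i))
  have hD1 : D.1.length = n := List.length_ofFn
  have hDf : ∀ i (hi : i < n), D.factor i = (Q ⟨i, hi⟩).code := fun i hi =>
    List.getD_ofFn _ _ hi
  have hDp : ∀ i (hi : i < n) u (hu : u < F.card), D.point i u = T ⟨i, hi⟩ ⟨u, hu⟩ := by
    intro i hi u hu
    change ((List.ofFn fun i => List.ofFn (T i)).getD i []).getD u _ = _
    rw [List.getD_ofFn _ _ hi, List.getD_ofFn _ _ hu]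
  have hedge : ∀ w ∈ W, ∀ a s, a :: s <:+ w → D.IsEdge f a (idx (a :: s)) (idx s) := by
    intro w hw a s has
    have haw : a ∈ w := has.subset List.mem_cons_self
    have hi : a.1.unpair.1 < n := by
      obtain ⟨w', -, rfl⟩ := List.mem_map.1 hw
      exact WordCode.unpair_lt_of_mem_subst hφ w' a haw
    have hs : pt (idx s) = pos s := hidx s (hF w hw s ((List.suffix_cons a s).trans has))
    have has' : pt (idx (a :: s)) = pos (a :: s) := hidx _ (hF w hw _ has)
    have hstep : (ρ.comp (inc ⟨_, hi⟩)) ((Q ⟨_, hi⟩).evalHom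
        (FreeGroup.mk [(a.1.unpair.2, a.2)])) (pt (idx s)) = pt (idx (a :: s)) := by
      rw [hs, has', MonoidHom.comp_apply, ← hπ]
      change _ = ρ (π (FreeGroup.mk ([a] ++ s))) x₀
      rw [← FreeGroup.mul_mk, map_mul, map_mul, Equiv.Perm.mul_apply]
      simp [FreeGroup.map.mk, pos]
    obtain ⟨h1, h2⟩ := hT2 ⟨_, hi⟩ _ _ (a.1.unpair.2, a.2)
      (List.mem_map.2 ⟨a, List.mem_flatten.2 ⟨w, hw, haw⟩, rfl⟩) hstep
    refine ⟨hD1 ▸ hi, (idx _).2, (idx _).2, ?_, ?_⟩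
    · rw [hDp _ hi _ (idx _).2, hDp _ hi _ (idx _).2]
      exact h1
    · rw [hDp _ hi _ (idx _).2, hDp _ hi _ (idx _).2, hDf _ hi]
      obtain ⟨b, hb, hbt⟩ := hQ ⟨_, hi⟩ (T ⟨_, hi⟩ (idx (a :: s))).1.2
        (FreeGroup.invRev (T ⟨_, hi⟩ (idx (a :: s))).2 ++
          (a.1.unpair.2, a.2) :: (T ⟨_, hi⟩ (idx s)).2)
      rwa [hbt.2 h2] at hb
  have hpath : ∀ w ∈ W, D.IsPath f w (idx w) (idx []) := fun w hw =>
    isPath_of_index (fun s => (idx s : ℕ)) (hedge w hw)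
  have hnil : pt (idx []) = x₀ := by
    rw [hidx [] (by rwa [hpos_nil]), hpos_nil]
  refine ⟨D, φ, idx [], ?_, ?_, ?_, (idx []).2, ?_, idx (WordCode.subst φ z.code), (idx _).2, ?_,
    hpath _ List.mem_cons_self⟩
  · intro i hi
    rw [hDf i (hD1 ▸ hi)]
    exact hQL _
  · intro r hr
    obtain ⟨r₀, hr₀, rfl⟩ := List.mem_map.1 hr
    refine Subgroup.normalClosure_mono ?_ (hrel r₀ hr₀)
    rintro _ ⟨_, ⟨i, r', hr', rfl⟩, rfl⟩
    refine ⟨_, ⟨i, hD1.symm ▸ i.2, r'.code, ?_, rfl⟩, rfl⟩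
    rw [hDf i i.2]
    exact List.mem_map_of_mem hr'
  · intro i hi u hu v hv
    replace hi : i < n := hD1 ▸ hi
    rw [hDp i hi u hu, hDp i hi v hv, hDf i hi, or_iff_not_imp_left, or_iff_not_imp_left, not_not]
    intro huv hτ
    have h := hT1 ⟨i, hi⟩ ⟨u, hu⟩ ⟨v, hv⟩ (fun h => huv (congrArg Fin.val h)) hτ
    obtain ⟨b, hb, hbt⟩ := hQ ⟨i, hi⟩ (T ⟨i, hi⟩ ⟨u, hu⟩).1.2
      (FreeGroup.invRev (T ⟨i, hi⟩ ⟨u, hu⟩).2 ++ (T ⟨i, hi⟩ ⟨v, hv⟩).2)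
    rw [← hbt, Bool.not_eq_true] at h
    rwa [h] at hb
  · intro y hy
    obtain ⟨w, hw, rfl⟩ := List.mem_map.1 hy
    have hwW : WordCode.subst φ w.code ∈ W :=
      List.mem_map_of_mem (List.mem_cons_of_mem _ (List.mem_map_of_mem hw))
    -- Numbers correspond injectively to cosets, so a word of the subgroup gives a path that closes
    -- up.
    have : idx (WordCode.subst φ w.code) = idx [] := by
      apply hpt
      rw [hnil, hidx _ (hF _ hwW _ (List.suffix_refl _)), hpos]
      exact Subgroup.subset_closure ⟨w, hw, rfl⟩
    have h := hpath _ hwW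
    rwa [this] at h
  · intro h
    refine hz ((hpos z).1 ?_)
    rw [← hnil, ← Fin.ext h, hidx _ (hF _ List.mem_cons_self _ (List.suffix_refl _))]

end PieceCode

/-! ### The decision procedure -/

theorem rePred_mk_mem_closure_sup :
    REPred fun x : PresentationCode × List WordCode × WordCode => FreeGroup.mk x.2.2 ∈
      Subgroup.closure {g | ∃ y, y ∈ x.2.1 ∧ g = FreeGroup.mk y} ⊔
        Subgroup.normalClosure {g | ∃ y, y ∈ x.1.2 ∧ g = FreeGroup.mk y} := by
  have hS : REPred fun p : (PresentationCode × List WordCode × WordCode) × WordCode =>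
      p.2 ∈ p.1.2.1 := .mem (by fun_prop) (by fun_prop)
  have hR : REPred fun p : (PresentationCode × List WordCode × WordCode) × WordCode =>
      p.2 ∈ p.1.1.2 := .mem (by fun_prop) (by fun_prop)
  have hz : Computable fun x : PresentationCode × List WordCode × WordCode => x.2.2 := by fun_prop
  have := REPred.mk_mem_closure_sup_normalClosure
    (S := fun (x : PresentationCode × List WordCode × WordCode) y => y ∈ x.2.1)
    (R := fun x y => y ∈ x.1.2) hS hR hz
  exact this

theorem rePred_exists_isNonmembershipCertificate
    {f : PresentationCode × List WordCode × WordCode →. Bool} (hf : Partrec f)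
    {L : ℕ → Option PresentationCode} (hL : Computable L) :
    REPred fun x : PresentationCode × List WordCode × WordCode =>
      ∃ (D : PieceCode) (φ : List WordCode) (b : ℕ), D.IsNonmembershipCertificate f L x φ b := by
  refine .ex (.ex (.ex ?_))
  refine PieceCode.rePred_isNonmembershipCertificate hf hL ?_ ?_ ?_ ?_ <;> fun_prop

theorem mainTheorem7 (C : GroupClass.{u}) (hre : RecursivelyEnumerableClass C)
    (hmp : MembershipProblemSolvable C) :
    MembershipProblemSolvable (FiniteFreeProductClass C) := by
  obtain ⟨L, hL, hLC, hCL⟩ := hre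
  obtain ⟨f, hf, hfC⟩ := hmp.exists_partrec
  obtain ⟨F, hF, h⟩ := REPred.exists_partrec_decide rePred_mk_mem_closure_sup
    (rePred_exists_isNonmembershipCertificate hf hL)
  refine ⟨F, hF, fun P hP ws z => ?_⟩
  have hiff := FinitePresentation.eval_mem_closure_iff ws z
  -- The two searches are complementary only under the promise `hP`, which is used for completeness;
  -- soundness does not need it.
  obtain ⟨b, hb, hbt⟩ := h (P.code, ws.map GroupWord.code, z.code) (by
    rw [← hiff]
    exact ⟨fun ⟨_, _, _, h⟩ => h.notMem hfC hLC,
      PieceCode.exists_isNonmembershipCertificate hfC hLC hCL hP⟩)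
  exact ⟨b, hb, hbt.trans hiff.symm⟩
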